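/- Let $0<a<1/2$ and $0<b<1/2$. On the unit square $[0,1]^2$, with Lebesgue measure $m$, consider the skew product $F_{a,b}(x,y)=(f(x),g_{a,b}(x,y))$, where $f$ is the doubling map ($f(x)=2x$ for $0\le x<1/2$, $f(x)=2x-1$ for $1/2\le x\le 1$) and $$g_{a,b}(x,y)=\begin{cases} y+ay(1-y), & 0\le x<1/2,\\ y-by(1-y), & 1/2\le x\le 1.\end{cases}$$ Let $A_0=[0,1]\times\{0\}$ and $A_1=[0,1]\times\{1\}$. Definitions. For a map $F$ of $[0,1]^2$ and a compact set $A$ with $F(A)=A$, the basin $\mathcal B(A)$ is the set of points whose $\omega$-limit set is contained in $A$, and $A$ is transitive if $\omega(p)=A$ for some $p\in A$. * $A$ is a Milnor attractor if $m(\mathcal B(A))>0$ and no compact proper subset $A'\subsetneq A$ has a basin that coincides with $\mathcal B(A)$ up to an $m$-null set. * $A$ is a chaotic Milnor attractor if it is a transitive Milnor attractor and supports an ergodic $F$-invariant probability measure $\mu$ (with support equal to $A$) that is not the only ergodic $F$-invariant probability measure supported on $A$ and for which at least one Lyapunov exponent is positive. * $A$ has a locally riddled basin if there is a neighbourhood $U$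 of $A$ such that $m\big(B_\varepsilon(x)\cap(\bigcap_{n\ge0}F^{-n}(U))^c\big)>0$ for all $x\in A$ and $\varepsilon>0$. * $A$ is a chaotic saddle if it is transitive and there is a neighbourhood $U$ of $A$ with $\mathcal B(A)\cap U\ne\emptyset$, but $m(\mathcal B(A))=0$. Theorem. 1. If $b<\dfrac{a}{1+a}$, then for $F_{a,b}$ the set $A_0$ is a chaotic saddle and $A_1$ is a chaotic Milnor attractor with a locally riddled basin. 2. If $\dfrac{a}{1-a}<b$, then for $F_{a,b}$ the set $A_1$ is a chaotic saddle and $A_0$ is a chaotic Milnor attractor with a locally riddled basin. -/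

import Mathlib

open Set Filter Topology MeasureTheory

namespace RiddledSkew

section General

variable {M : Type*} [MetricSpace M] [MeasurableSpace M]

/-- The omega-limit set of the forward orbit of `p`. -/
def omegaSet (F : M → M) (p : M) : Set M :=
  omegaLimit atTop (fun (n : ℕ) (q : M) => F^[n] q) {p}

/-- The basin of attraction of `A`: all points whose omega-limit set is contained in `A`. -/
def basin (F : M → M) (A : Set M) : Set M :=
  {p | omegaSet F p ⊆ A}

/-- A compact set with `F(A) = A`. -/
def IsCompactInvariant (F : M → M) (A : Set M) : Prop :=
  IsCompact A ∧ F '' A = A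

/-- Transitivity: some point of `A` has an orbit whose omega-limit set is all of `A`. -/
def IsTransitiveSet (F : M → M) (A : Set M) : Prop :=
  ∃ p ∈ A, omegaSet F p = A

/-- A Milnor attractor: the basin has positive measure, and no compact proper subset of `A`
has the same basin up to a null set. -/
def IsMilnorAttractor (F : M → M) (m : Measure M) (A : Set M) : Prop :=
  IsCompactInvariant F A ∧ 0 < m (basin F A) ∧
    ∀ A' : Set M, IsCompact A' → A' ⊂ A → ¬ (basin F A' =ᵐ[m] basin F A)

/-- The riddling condition: for some neighbourhood `U` of `A`, every ball around every point of
`A` contains a set of positive measure of points whose forward orbit leaves `U`. -/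
def HasLocallyRiddledBasin (F : M → M) (m : Measure M) (A : Set M) : Prop :=
  ∃ U : Set M, IsOpen U ∧ A ⊆ U ∧
    ∀ x ∈ A, ∀ ε : ℝ, 0 < ε →
      0 < m (Metric.ball x ε ∩ (⋂ n : ℕ, (F^[n]) ⁻¹' U)ᶜ)

/-- A chaotic saddle: an invariant transitive set with a neighbourhood that meets the basin,
while the basin has measure zero. -/
def IsChaoticSaddle (F : M → M) (m : Measure M) (A : Set M) : Prop :=
  IsCompactInvariant F A ∧ IsTransitiveSet F A ∧
    (∃ U : Set M, IsOpen U ∧ A ⊆ U ∧ (basin F A ∩ U).Nonempty) ∧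
    m (basin F A) = 0

/-- `μ` is an ergodic `F`-invariant probability measure supported on `A`. -/
def IsErgodicOn (F : M → M) (A : Set M) (μ : Measure M) : Prop :=
  IsProbabilityMeasure μ ∧ Ergodic F μ ∧ μ Aᶜ = 0

end General

/-- The unit square `[0,1] × [0,1]` as a subset of the plane. -/
def unitSquare : Set (ℝ × ℝ) := Icc (0 : ℝ) 1 ×ˢ Icc (0 : ℝ) 1

/-- The unit square as a space, with the metric and Borel structure of the plane. -/
abbrev Square : Type := ↥unitSquare

/-- Lebesgue measure on the unit square (a probability measure). -/
noncomputable def lebesgue : Measure Square := (volume : Measure (ℝ × ℝ)).comap Subtype.val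

/-- A self-map of the square, viewed as a map on the plane (its values off the square are
irrelevant: it is only differentiated within the square). -/
noncomputable def planar (G : Square → Square) : ℝ × ℝ → ℝ × ℝ :=
  Function.extend Subtype.val (fun p => (G p : ℝ × ℝ)) 0

/-- `l = lim (1/n) log ‖d(Fⁿ)(p) v‖` is the Lyapunov exponent of `F` at `p` in direction `v`;
all the derivatives are required to exist (one-sided at the boundary of the square). -/
def HasLyapunovExponent (F : Square → Square) (p : Square) (v : ℝ × ℝ) (l : ℝ) : Prop :=
  (∀ n : ℕ, DifferentiableWithinAt ℝ (planar F^[n]) unitSquare (p : ℝ × ℝ)) ∧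
  Tendsto
    (fun n : ℕ => (1 / (n : ℝ)) *
      Real.log ‖fderivWithin ℝ (planar F^[n]) unitSquare (p : ℝ × ℝ) v‖)
    atTop (𝓝 l)

/-- A chaotic (Milnor) attractor: a transitive Milnor attractor that supports an ergodic
probability measure `μ` (the support of `μ` is all of `A`) which is not the only ergodic
probability measure on `A` and which has a positive Lyapunov exponent. -/
def IsChaoticAttractor (F : Square → Square) (m : Measure Square) (A : Set Square) : Prop :=
  IsMilnorAttractor F m A ∧ IsTransitiveSet F A ∧
    ∃ μ : Measure Square, IsErgodicOn F A μ ∧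
      (∀ U : Set Square, IsOpen U → (A ∩ U).Nonempty → 0 < μ U) ∧
      (∃ ν : Measure Square, IsErgodicOn F A ν ∧ ν ≠ μ) ∧
      ∃ l : ℝ, 0 < l ∧ ∀ᵐ p ∂μ, ∃ v : ℝ × ℝ, HasLyapunovExponent F p v l

/-- The doubling map on `[0,1]`, with the full right branch `[1/2,1] → [0,1]`, so that
both `0` and `1` are fixed. -/
noncomputable def doubling (x : ℝ) : ℝ :=
  if x < 1 / 2 then 2 * x else 2 * x - 1

/-- The fibre maps: `g_a` over `[0,1/2)` and `g_b` over `[1/2,1]`. -/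
noncomputable def fibre (a b x y : ℝ) : ℝ :=
  if x < 1 / 2 then y + a * y * (1 - y) else y - b * y * (1 - y)

theorem mapsTo_unitSquare {a b : ℝ} (ha : a ∈ Ioo (0 : ℝ) (1 / 2)) (hb : b ∈ Ioo (0 : ℝ) (1 / 2))
    {p : ℝ × ℝ} (hp : p ∈ unitSquare) :
    (doubling p.1, fibre a b p.1 p.2) ∈ unitSquare := by
  obtain ⟨ha0, ha1⟩ := ha
  obtain ⟨hb0, hb1⟩ := hb
  obtain ⟨⟨hx0, hx1⟩, hy0, hy1⟩ := hp
  have h : 0 ≤ p.2 * (1 - p.2) := mul_nonneg hy0 (by linarith)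
  have h1 : p.2 * (1 - p.2) ≤ p.2 := by nlinarith
  have h2 : p.2 * (1 - p.2) ≤ 1 - p.2 := by nlinarith
  refine ⟨?_, ?_⟩
  · show doubling p.1 ∈ Icc (0 : ℝ) 1
    unfold doubling
    split_ifs with hx
    · exact ⟨by linarith, by linarith⟩
    · exact ⟨by linarith, by linarith⟩
  · show fibre a b p.1 p.2 ∈ Icc (0 : ℝ) 1
    unfold fibre
    split_ifs with hx
    · exact ⟨by nlinarith, by nlinarith⟩
    · exact ⟨by nlinarith, by nlinarith⟩

/-- The skew product `F_{a,b}(x,y) = (f(x), g_{a,b}(x,y))` on the unit square. -/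
noncomputable def skewMap (a b : ℝ) (ha : a ∈ Ioo (0 : ℝ) (1 / 2))
    (hb : b ∈ Ioo (0 : ℝ) (1 / 2)) (p : Square) : Square :=
  ⟨(doubling p.1.1, fibre a b p.1.1 p.1.2), mapsTo_unitSquare ha hb p.2⟩

/-- The bottom edge `A₀ = [0,1] × {0}`. -/
def bottomEdge : Set Square := {p | p.1.2 = 0}

/-- The top edge `A₁ = [0,1] × {1}`. -/
def topEdge : Set Square := {p | p.1.2 = 1}

end RiddledSkew

/-!
In the coordinate `logit y = log (y / (1 - y))` on the open fibre, one step of the skew product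
raises the height by an amount that lies between the transversal growth rates at the two edges:
over the left half between `log (1 + a)` and `-log (1 - a)`, over the right half between
`log (1 - b)` and `-log (1 + b)` (`le_logit_fibre`, `logit_fibre_le`). The height of an orbit is
therefore bounded below and above by sums along the base orbit of observables that only depend on
the first binary digit. The digits of a Lebesgue-random point are pairwise independent and have mean
one half, so by the strong law of large numbers these sums drift with the sign of their mean
(`ae_tendsto_sum_atTop`). If `b < a / (1 + a)`, then `log (1 + a) + log (1 - b) > 0` and almost every
orbit tends to the top edge; if `a / (1 - a) < b`, then `log (1 - a) + log (1 + b) > 0` and almost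
every orbit tends to the bottom edge.

The doubling map is a factor of the doubling map of the circle, hence ergodic, and almost every base
orbit is dense. Together with the convergence of the heights, this shows that the limit set of almost
every point of the square is one full edge (`ae_omegaSet_eq_topEdge`, `ae_omegaSet_eq_bottomEdge`).
This yields at once that this edge is a Milnor attractor, with no smaller set having the same basin,
and that the basin of the other edge is null. Lebesgue measure on the edge is ergodic and has full
support, it differs from the point mass at the fixed endpoint, and horizontal vectors grow like
`2 ^ n` (`hasLyapunovExponent_log_two`).

Each edge is also repelling over one of the two halves. A point close to the edge can move towards it
by a bounded factor during the first `N` steps, and a sufficiently long run of the repelling digit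
afterwards carries it past height `1 / 2`. Since `N` digits suffice to locate the base point in a
given ball, every ball contains a rectangle of such points (`hasLocallyRiddledBasin_bottomEdge`,
`hasLocallyRiddledBasin_topEdge`).
-/

namespace RiddledSkew

open ProbabilityTheory

/-! ### The doubling map is ergodic -/

/-- Lebesgue measure on the unit interval, as a measure on the line. -/
noncomputable def unitVolume : Measure ℝ := volume.restrict (Icc 0 1)

instance : IsProbabilityMeasure unitVolume :=
  ⟨by simp [unitVolume]⟩

theorem measurable_doubling : Measurable doubling :=
  Measurable.ite measurableSet_Iio (by fun_prop) (by fun_prop)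

theorem doubling_eq_fract {x : ℝ} (hx : x ∈ Ico (0 : ℝ) 1) : doubling x = Int.fract (2 * x) := by
  obtain ⟨h0, h1⟩ := hx
  unfold doubling
  split_ifs with h
  · exact (Int.fract_eq_self.2 ⟨by linarith, by linarith⟩).symm
  · symm
    rw [Int.fract_eq_iff]
    exact ⟨by linarith, by linarith, 1, by push_cast; ring⟩

theorem iterate_doubling_eq_fract {x : ℝ} (hx : x ∈ Ico (0 : ℝ) 1) (n : ℕ) :
    doubling^[n] x = Int.fract (2 ^ n * x) := by
  induction n with
  | zero => simpa using (Int.fract_eq_self.2 hx).symm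
  | succ n ih =>
    rw [Function.iterate_succ_apply', ih,
      doubling_eq_fract ⟨Int.fract_nonneg _, Int.fract_lt_one _⟩, Int.fract_eq_fract]
    exact ⟨-2 * ⌊(2 : ℝ) ^ n * x⌋, by unfold Int.fract; push_cast; ring⟩

/-- The representative in `[0,1)` of a point of the circle `ℝ / ℤ`. It is a semiconjugacy from the
doubling map of the circle to the doubling map of the interval. -/
noncomputable def circleRep (t : UnitAddCircle) : ℝ := (AddCircle.equivIco 1 0 t : ℝ)

theorem circleRep_mem_Ico (t : UnitAddCircle) : circleRep t ∈ Ico (0 : ℝ) 1 := by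
  simpa only [circleRep, zero_add] using (AddCircle.equivIco (1 : ℝ) 0 t).2

theorem circleRep_coe (x : ℝ) : circleRep (x : UnitAddCircle) = Int.fract x := by
  simpa only [circleRep, div_one, mul_one] using AddCircle.coe_equivIco_mk_apply (1 : ℝ) x

theorem measurePreserving_circleRep : MeasurePreserving circleRep volume unitVolume := by
  have hm : Measurable circleRep :=
    measurable_subtype_coe.comp (AddCircle.measurableEquivIco (1 : ℝ) 0).measurable
  refine ⟨hm, ?_⟩
  rw [← (UnitAddCircle.measurePreserving_mk 0).map_eq,
    Measure.map_map hm (UnitAddCircle.measurePreserving_mk 0).measurable]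
  have h : (circleRep ∘ fun x : ℝ => (x : UnitAddCircle)) =ᵐ[volume.restrict (Ioc 0 (0 + 1))] id := by
    rw [zero_add, ← restrict_Ioo_eq_restrict_Ioc]
    filter_upwards [ae_restrict_mem measurableSet_Ioo] with x hx
    simpa [circleRep_coe] using Int.fract_eq_self.2 ⟨hx.1.le, hx.2⟩
  refine (Measure.map_congr h).trans ?_
  rw [Measure.map_id, zero_add, restrict_Ioc_eq_restrict_Icc]
  rfl

theorem semiconj_circleRep :
    Function.Semiconj circleRep (fun t : UnitAddCircle => 2 • t) doubling := by
  intro t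
  obtain ⟨x, rfl⟩ := QuotientAddGroup.mk_surjective t
  change circleRep (2 • (x : UnitAddCircle)) = doubling (circleRep (x : UnitAddCircle))
  rw [doubling_eq_fract (circleRep_mem_Ico _), ← AddCircle.coe_nsmul, circleRep_coe, circleRep_coe,
    Int.fract_eq_fract]
  exact ⟨2 * ⌊x⌋, by unfold Int.fract; push_cast; rw [nsmul_eq_mul]; push_cast; ring⟩

theorem ergodic_doubling : Ergodic doubling unitVolume :=
  measurePreserving_circleRep.ergodic_of_ergodic_semiconj (AddCircle.ergodic_nsmul one_lt_two)
    measurable_doubling semiconj_circleRep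

/-! ### Density of almost every orbit -/

/-- Almost every orbit of an ergodic map of a probability space visits a given set of positive
measure infinitely often: the set of such orbits is invariant, and by Poincaré recurrence it
contains almost all of the given set. -/
theorem _root_.Ergodic.ae_frequently_mem {α : Type*} [MeasurableSpace α] {μ : Measure α}
    [IsFiniteMeasure μ] {f : α → α} (hf : Ergodic f μ) {s : Set α} (hs : MeasurableSet s)
    (h : μ s ≠ 0) : ∀ᵐ x ∂μ, ∃ᶠ n in atTop, f^[n] x ∈ s := by
  have hm : MeasurableSet {x | ∃ᶠ n in atTop, f^[n] x ∈ s} := by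
    have : {x | ∃ᶠ n in atTop, f^[n] x ∈ s} = limsup (fun n => f^[n] ⁻¹' s) atTop := by
      ext x
      simp [mem_limsup_iff_frequently_mem]
    rw [this]
    exact MeasurableSet.measurableSet_limsup fun n => hf.measurable.iterate n hs
  have hinv : f ⁻¹' {x | ∃ᶠ n in atTop, f^[n] x ∈ s} = {x | ∃ᶠ n in atTop, f^[n] x ∈ s} := by
    ext x
    change (∃ᶠ n in atTop, f^[n + 1] x ∈ s) ↔ ∃ᶠ n in atTop, f^[n] x ∈ s
    rw [← Filter.frequently_map (m := fun n => n + 1) (P := fun n => f^[n] x ∈ s),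
      Filter.map_add_atTop_eq_nat]
  rcases hf.ae_mem_or_ae_notMem hm hinv with h1 | h1
  · exact h1
  · refine absurd (measure_eq_zero_iff_ae_notMem.2 ?_) h
    filter_upwards [h1, hf.conservative.ae_mem_imp_frequently_image_mem hs.nullMeasurableSet]
      with x hx hx' hxs using hx (hx' hxs)

theorem unitVolume_pos_of_isOpen {U : Set ℝ} (hU : IsOpen U) {x : ℝ} (hx : x ∈ Icc (0 : ℝ) 1)
    (hxU : x ∈ U) : 0 < unitVolume U := by
  rw [unitVolume, Measure.restrict_apply hU.measurableSet]
  have hne : (U ∩ Ioo (0 : ℝ) 1).Nonempty := by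
    have : x ∈ closure (Ioo (0 : ℝ) 1) := by rwa [closure_Ioo zero_ne_one]
    exact mem_closure_iff.1 this U hU hxU
  exact ((hU.inter isOpen_Ioo).measure_pos volume hne).trans_le
    (measure_mono (inter_subset_inter_right _ Ioo_subset_Icc_self))

theorem ae_mapClusterPt_doubling :
    ∀ᵐ x ∂unitVolume, ∀ z ∈ Icc (0 : ℝ) 1, MapClusterPt z atTop fun n => doubling^[n] x := by
  obtain ⟨b, hbc, -, hb⟩ := TopologicalSpace.exists_countable_basis ℝ
  have h : ∀ U ∈ b, ∀ᵐ x ∂unitVolume, (U ∩ Icc (0 : ℝ) 1).Nonempty →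
      ∃ᶠ n in atTop, doubling^[n] x ∈ U := by
    intro U hU
    by_cases hne : (U ∩ Icc (0 : ℝ) 1).Nonempty
    · obtain ⟨z, hzU, hz⟩ := hne
      filter_upwards [ergodic_doubling.ae_frequently_mem (hb.isOpen hU).measurableSet
        (unitVolume_pos_of_isOpen (hb.isOpen hU) hz hzU).ne'] with x hx _ using hx
    · exact ae_of_all _ fun x hx => absurd hx hne
  filter_upwards [(ae_ball_iff hbc).2 h] with x hx z hz
  rw [hb.nhds_hasBasis.mapClusterPt_iff_frequently]
  exact fun U hU => hx U hU.1 ⟨z, hU.2, hz⟩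

/-! ### Frequency of binary digits -/

/-- The left half of the interval and a preimage of a set under the doubling map are independent,
because the doubling map sends the left half affinely onto the interval. -/
theorem unitVolume_Iio_inter_preimage {E : Set ℝ} :
    unitVolume (Iio (1 / 2) ∩ doubling ⁻¹' E) = 2⁻¹ * unitVolume E := by
  have h1 : unitVolume E = volume (E ∩ Ico (0 : ℝ) 1) := by
    rw [unitVolume, ← restrict_Ico_eq_restrict_Icc, Measure.restrict_apply' measurableSet_Ico]
  have h2 : unitVolume (Iio (1 / 2) ∩ doubling ⁻¹' E)
      = volume ((fun x : ℝ => 2 * x) ⁻¹' (E ∩ Ico (0 : ℝ) 1)) := by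
    rw [unitVolume, Measure.restrict_apply' measurableSet_Icc]
    congr 1
    ext x
    simp only [mem_inter_iff, mem_Iio, mem_preimage, mem_Icc, mem_Ico, doubling]
    constructor
    · rintro ⟨⟨hx, hE⟩, h0, -⟩
      rw [if_pos hx] at hE
      exact ⟨hE, by linarith, by linarith⟩
    · rintro ⟨hE, h0, h1⟩
      have hx : x < 1 / 2 := by linarith
      rw [if_pos hx]
      exact ⟨⟨hx, hE⟩, by linarith, by linarith⟩
  rw [h1, h2, Real.volume_preimage_mul_left two_ne_zero]
  congr 1
  rw [abs_of_pos (by norm_num), ENNReal.ofReal_inv_of_pos two_pos]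
  simp

theorem unitVolume_Iio : unitVolume (Iio (1 / 2)) = 2⁻¹ := by
  simpa using unitVolume_Iio_inter_preimage (E := univ)

/-- The event that the `n`-th binary digit is `0`. -/
def digitZero (n : ℕ) : Set ℝ := doubling^[n] ⁻¹' Iio (1 / 2)

theorem measurableSet_digitZero (n : ℕ) : MeasurableSet (digitZero n) :=
  measurable_doubling.iterate n measurableSet_Iio

theorem indepSet_digitZero {i j : ℕ} (hij : i < j) :
    IndepSet (digitZero i) (digitZero j) unitVolume := by
  rw [indepSet_iff_measure_inter_eq_mul (measurableSet_digitZero i)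
    (measurableSet_digitZero j) unitVolume]
  have hmp := fun n => ergodic_doubling.toMeasurePreserving.iterate n
  have h (n : ℕ) : unitVolume (digitZero n) = 2⁻¹ := by
    rw [digitZero, (hmp n).measure_preimage measurableSet_Iio.nullMeasurableSet, unitVolume_Iio]
  obtain ⟨k, rfl⟩ := Nat.exists_eq_add_of_lt hij
  have : digitZero i ∩ digitZero (i + k + 1)
      = doubling^[i] ⁻¹' (Iio (1 / 2) ∩ doubling ⁻¹' digitZero k) := by
    ext x
    simp only [digitZero, mem_inter_iff, mem_preimage]
    rw [← Function.iterate_succ_apply, ← Function.iterate_add_apply,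
      show k.succ + i = i + k + 1 by omega]
  rw [this, (hmp i).measure_preimage (measurableSet_Iio.inter
    (measurable_doubling (measurableSet_digitZero k))).nullMeasurableSet,
    unitVolume_Iio_inter_preimage, h, h, h]

theorem indepFun_indicator_of_indepSet {Ω : Type*} [MeasurableSpace Ω] {μ : Measure Ω}
    {s t : Set Ω} (h : IndepSet s t μ) :
    IndepFun (s.indicator fun _ => (1 : ℝ)) (t.indicator fun _ => (1 : ℝ)) μ := by
  have key (s : Set Ω) : (inferInstance : MeasurableSpace ℝ).comap (s.indicator fun _ => (1 : ℝ))
      ≤ MeasurableSpace.generateFrom {s} := by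
    rw [← measurable_iff_comap_le]
    exact measurable_const.indicator (MeasurableSpace.measurableSet_generateFrom rfl)
  exact indep_of_indep_of_le_left (indep_of_indep_of_le_right h (key t)) (key s)

/-- For almost every point, the binary digit `0` has frequency one half. -/
theorem ae_tendsto_digit_frequency : ∀ᵐ x ∂unitVolume,
    Tendsto (fun n : ℕ => (∑ i ∈ Finset.range n, (digitZero i).indicator (fun _ => (1 : ℝ)) x) / n)
      atTop (𝓝 (1 / 2)) := by
  have hm (i : ℕ) : Measurable ((digitZero i).indicator fun _ => (1 : ℝ)) :=
    measurable_const.indicator (measurableSet_digitZero i)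
  have h := strong_law_ae_real (μ := unitVolume)
    (fun i => (digitZero i).indicator fun _ => (1 : ℝ)) ?_ ?_ ?_
  · have hi : ∫ x, (digitZero 0).indicator (fun _ => (1 : ℝ)) x ∂unitVolume = 1 / 2 := by
      rw [integral_indicator (measurableSet_digitZero 0)]
      simp only [integral_const, smul_eq_mul, mul_one, measureReal_restrict_apply_univ]
      rw [measureReal_def, digitZero, Function.iterate_zero, preimage_id, unitVolume_Iio]
      simp
    rwa [hi] at h
  · exact (integrable_const _).indicator (measurableSet_digitZero 0)
  · intro i j hij
    rcases lt_or_gt_of_ne hij with h | h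
    · exact indepFun_indicator_of_indepSet (indepSet_digitZero h)
    · exact (indepFun_indicator_of_indepSet (indepSet_digitZero h)).symm
  · intro i
    refine ⟨(hm i).aemeasurable, (hm 0).aemeasurable, ?_⟩
    have hc : (digitZero i).indicator (fun _ => (1 : ℝ))
        = (digitZero 0).indicator (fun _ => (1 : ℝ)) ∘ doubling^[i] := rfl
    rw [hc, ← Measure.map_map (hm 0) (measurable_doubling.iterate i),
      (ergodic_doubling.toMeasurePreserving.iterate i).map_eq]

/-- Along almost every orbit, sums of an observable that takes the value `c₀` on the left half and
`c₁` on the right half tend to infinity if `c₀ + c₁ > 0`. -/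
theorem ae_tendsto_sum_atTop {c₀ c₁ : ℝ} (hc : 0 < c₀ + c₁) : ∀ᵐ x ∂unitVolume,
    Tendsto (fun n : ℕ => ∑ i ∈ Finset.range n, if doubling^[i] x < 1 / 2 then c₀ else c₁)
      atTop atTop := by
  filter_upwards [ae_tendsto_digit_frequency] with x hx
  have h1 : Tendsto (fun n : ℕ => (n : ℝ) * (c₁ + (c₀ - c₁) *
      ((∑ i ∈ Finset.range n, (digitZero i).indicator (fun _ => (1 : ℝ)) x) / n))) atTop atTop := by
    refine tendsto_natCast_atTop_atTop.atTop_mul_pos (C := c₁ + (c₀ - c₁) * (1 / 2)) (by linarith) ?_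
    exact tendsto_const_nhds.add (tendsto_const_nhds.mul hx)
  refine h1.congr fun n => ?_
  rcases n.eq_zero_or_pos with rfl | hn
  · simp
  have hs : ∀ i, (if doubling^[i] x < 1 / 2 then c₀ else c₁)
      = c₁ + (c₀ - c₁) * (digitZero i).indicator (fun _ => (1 : ℝ)) x := by
    intro i
    by_cases h : doubling^[i] x < 1 / 2
    · rw [if_pos h, indicator_of_mem (show x ∈ digitZero i from h)]; ring
    · rw [if_neg h, indicator_of_notMem (show x ∉ digitZero i from h)]; ring
  simp_rw [hs]
  rw [Finset.sum_add_distrib, ← Finset.mul_sum]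
  have : (n : ℝ) ≠ 0 := by positivity
  simp only [Finset.sum_const, Finset.card_range, nsmul_eq_mul]
  field_simp

/-! ### Basins and almost sure limit sets -/

section General

variable {M : Type*} [MetricSpace M] {F : M → M}

theorem mem_omegaSet_iff {p q : M} : q ∈ omegaSet F p ↔ MapClusterPt q atTop fun n => F^[n] p :=
  mem_omegaLimit_singleton_iff_mapClusterPt _ _ _ _

variable [MeasurableSpace M] {m : Measure M} {A : Set M}

/-- If the limit set of almost every orbit is all of `A`, then every set that does not contain `A`
has a null basin. -/
theorem measure_basin_eq_zero (h : ∀ᵐ p ∂m, omegaSet F p = A) {B : Set M} (hB : ¬ A ⊆ B) :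
    m (basin F B) = 0 := by
  rw [measure_eq_zero_iff_ae_notMem]
  filter_upwards [h] with p hp hpB
  exact hB (hp ▸ hpB)

theorem isMilnorAttractor_of_ae_omegaSet_eq (hA : IsCompactInvariant F A) (hm : m ≠ 0)
    (h : ∀ᵐ p ∂m, omegaSet F p = A) : IsMilnorAttractor F m A := by
  have hpos : 0 < m (basin F A) := by
    have : basin F A =ᵐ[m] univ := eventuallyEq_univ.2 (h.mono fun p hp => hp.subset)
    rw [measure_congr this]
    exact pos_iff_ne_zero.2 (Measure.measure_univ_ne_zero.2 hm)
  refine ⟨hA, hpos, fun A' _ hA' heq => hpos.ne' ?_⟩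
  rw [← measure_congr heq]
  exact measure_basin_eq_zero h hA'.2

end General

/-! ### Lebesgue measure on the square -/

theorem measurableSet_unitSquare : MeasurableSet unitSquare :=
  measurableSet_Icc.prod measurableSet_Icc

instance : CompactSpace Square :=
  isCompact_iff_compactSpace.1 (isCompact_Icc.prod isCompact_Icc)

theorem lebesgue_apply (s : Set Square) : lebesgue s = volume (Subtype.val '' s) :=
  comap_subtype_coe_apply measurableSet_unitSquare volume s

theorem lebesgue_ne_zero : lebesgue ≠ 0 := by
  rw [← Measure.measure_univ_ne_zero, lebesgue_apply, image_univ, Subtype.range_coe, unitSquare,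
    Measure.volume_eq_prod, Measure.prod_prod]
  simp

theorem lebesgue_pos_of_Ioo {l r l' r' : ℝ} (h : l < r) (h' : l' < r') (hs : Ioo l r ⊆ Ioo 0 1)
    (hs' : Ioo l' r' ⊆ Ioo 0 1) :
    0 < lebesgue {p : Square | p.1.1 ∈ Ioo l r ∧ p.1.2 ∈ Ioo l' r'} := by
  rw [lebesgue_apply]
  refine ((isOpen_Ioo.prod isOpen_Ioo).measure_pos volume
    ((nonempty_Ioo.2 h).prod (nonempty_Ioo.2 h'))).trans_le (measure_mono ?_)
  rintro ⟨x, y⟩ ⟨hx, hy⟩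
  exact ⟨⟨(x, y), Ioo_subset_Icc_self (hs hx), Ioo_subset_Icc_self (hs' hy)⟩, ⟨hx, hy⟩, rfl⟩

theorem ae_lebesgue_of_ae_unitVolume {P : ℝ → Prop} (h : ∀ᵐ x ∂unitVolume, P x) :
    ∀ᵐ p : Square ∂lebesgue, P p.1.1 ∧ p.1.2 ∈ Ioo (0 : ℝ) 1 := by
  have h0 : volume ({x | ¬ P x} ∩ Icc (0 : ℝ) 1) = 0 := by
    rwa [← Measure.restrict_apply' measurableSet_Icc]
  rw [ae_iff, lebesgue_apply]
  refine measure_mono_null (t := (({x | ¬ P x} ∩ Icc (0 : ℝ) 1) ×ˢ univ) ∪ (univ ×ˢ {0, 1})) ?_ ?_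
  · rintro _ ⟨⟨⟨x, y⟩, hx, hy⟩, hp, rfl⟩
    by_cases hP : P x
    · refine Or.inr ⟨trivial, ?_⟩
      by_contra hne
      simp only [mem_insert_iff, mem_singleton_iff, not_or] at hne
      exact hp ⟨hP, lt_of_le_of_ne hy.1 (Ne.symm hne.1), lt_of_le_of_ne hy.2 hne.2⟩
    · exact Or.inl ⟨⟨hP, hx⟩, trivial⟩
  · have h2 : volume ({0, 1} : Set ℝ) = 0 := (Set.toFinite _).measure_zero _
    rw [measure_union_null_iff, Measure.volume_eq_prod, Measure.prod_prod, Measure.prod_prod, h0, h2]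
    simp

/-! ### The height in logistic coordinates -/

/-- The horizontal segment at height `c`. -/
def edge (c : ℝ) : Set Square := {p | p.1.2 = c}

theorem isClosed_edge (c : ℝ) : IsClosed (edge c) :=
  isClosed_eq (continuous_snd.comp continuous_subtype_val) continuous_const

/-- The logarithm of the odds `y / (1 - y)`, the inverse of `Real.sigmoid` on `(0,1)`. -/
noncomputable def logit (y : ℝ) : ℝ := Real.log y - Real.log (1 - y)

theorem sigmoid_logit {y : ℝ} (hy : y ∈ Ioo (0 : ℝ) 1) : Real.sigmoid (logit y) = y := by
  obtain ⟨h0, h1⟩ := hy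
  have : 0 < 1 - y := by linarith
  rw [Real.sigmoid_def, logit, neg_sub, Real.exp_sub, Real.exp_log h0, Real.exp_log this]
  field_simp
  ring

theorem logit_le_logit {y z : ℝ} (hy : y ∈ Ioo (0 : ℝ) 1) (hz : z ∈ Ioo (0 : ℝ) 1) (h : y ≤ z) :
    logit y ≤ logit z :=
  sub_le_sub (Real.log_le_log hy.1 h) (Real.log_le_log (by linarith [hz.2]) (by linarith))

section Edges

variable {a b : ℝ}

theorem fibre_mem_Ioo (ha : a ∈ Ioo (0 : ℝ) (1 / 2)) (hb : b ∈ Ioo (0 : ℝ) (1 / 2)) (x : ℝ)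
    {y : ℝ} (hy : y ∈ Ioo (0 : ℝ) 1) : fibre a b x y ∈ Ioo (0 : ℝ) 1 := by
  obtain ⟨ha0, ha1⟩ := ha
  obtain ⟨hb0, hb1⟩ := hb
  obtain ⟨h0, h1⟩ := hy
  have hy' : 0 < 1 - y := by linarith
  unfold fibre
  split_ifs
  · have h : 0 < (1 - y) * (1 - a * y) := mul_pos hy' (by nlinarith)
    have h' : 0 < y * (1 + a * (1 - y)) := by positivity
    constructor <;> nlinarith
  · have h : 0 < (1 - y) * (1 + b * y) := by positivity
    have h' : 0 < y * (1 - b * (1 - y)) := mul_pos h0 (by nlinarith)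
    constructor <;> nlinarith

/-- In the coordinate `logit`, a step of the fibre map increases the height at least by the amount
`log (1 + a)` or `log (1 - b)` by which it does so in the limit at the bottom edge. -/
theorem le_logit_fibre (ha : a ∈ Ioo (0 : ℝ) (1 / 2)) (hb : b ∈ Ioo (0 : ℝ) (1 / 2)) (x : ℝ)
    {y : ℝ} (hy : y ∈ Ioo (0 : ℝ) 1) :
    logit y + (if x < 1 / 2 then Real.log (1 + a) else Real.log (1 - b)) ≤
      logit (fibre a b x y) := by
  obtain ⟨ha0, ha1⟩ := ha
  obtain ⟨hb0, hb1⟩ := hb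
  obtain ⟨h0, h1⟩ := hy
  have hy' : 0 < 1 - y := by linarith
  unfold fibre logit
  split_ifs
  · have e1 : y + a * y * (1 - y) = y * (1 + a * (1 - y)) := by ring
    have e2 : 1 - y * (1 + a * (1 - y)) = (1 - y) * (1 - a * y) := by ring
    have p1 : 0 < 1 + a * (1 - y) := by positivity
    have p2 : 0 < 1 - a * y := by nlinarith
    have key : Real.log ((1 + a) * (1 - a * y)) ≤ Real.log (1 + a * (1 - y)) :=
      Real.log_le_log (by positivity) (by nlinarith [mul_pos (mul_pos ha0 ha0) h0])
    rw [Real.log_mul (by positivity) p2.ne'] at key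
    rw [e1, e2, Real.log_mul h0.ne' p1.ne', Real.log_mul hy'.ne' p2.ne']
    linarith
  · have e1 : y - b * y * (1 - y) = y * (1 - b * (1 - y)) := by ring
    have e2 : 1 - y * (1 - b * (1 - y)) = (1 - y) * (1 + b * y) := by ring
    have p1 : 0 < 1 - b * (1 - y) := by nlinarith
    have p2 : 0 < 1 + b * y := by positivity
    have p3 : 0 < 1 - b := by linarith
    have key : Real.log ((1 - b) * (1 + b * y)) ≤ Real.log (1 - b * (1 - y)) :=
      Real.log_le_log (by positivity) (by nlinarith [mul_pos (mul_pos hb0 hb0) h0])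
    rw [Real.log_mul p3.ne' p2.ne'] at key
    rw [e1, e2, Real.log_mul h0.ne' p1.ne', Real.log_mul hy'.ne' p2.ne']
    linarith

/-- In the coordinate `logit`, a step of the fibre map increases the height at most by the amount
`-log (1 - a)` or `-log (1 + b)` by which it does so in the limit at the top edge. -/
theorem logit_fibre_le (ha : a ∈ Ioo (0 : ℝ) (1 / 2)) (hb : b ∈ Ioo (0 : ℝ) (1 / 2)) (x : ℝ)
    {y : ℝ} (hy : y ∈ Ioo (0 : ℝ) 1) :
    logit (fibre a b x y) ≤
      logit y + (if x < 1 / 2 then -Real.log (1 - a) else -Real.log (1 + b)) := by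
  obtain ⟨ha0, ha1⟩ := ha
  obtain ⟨hb0, hb1⟩ := hb
  obtain ⟨h0, h1⟩ := hy
  have hy' : 0 < 1 - y := by linarith
  unfold fibre logit
  split_ifs
  · have e1 : y + a * y * (1 - y) = y * (1 + a * (1 - y)) := by ring
    have e2 : 1 - y * (1 + a * (1 - y)) = (1 - y) * (1 - a * y) := by ring
    have p1 : 0 < 1 + a * (1 - y) := by positivity
    have p2 : 0 < 1 - a * y := by nlinarith
    have p3 : 0 < 1 - a := by linarith
    have key : Real.log ((1 - a) * (1 + a * (1 - y))) ≤ Real.log (1 - a * y) :=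
      Real.log_le_log (by positivity) (by nlinarith [mul_pos (mul_pos ha0 ha0) hy'])
    rw [Real.log_mul p3.ne' p1.ne'] at key
    rw [e1, e2, Real.log_mul h0.ne' p1.ne', Real.log_mul hy'.ne' p2.ne']
    linarith
  · have e1 : y - b * y * (1 - y) = y * (1 - b * (1 - y)) := by ring
    have e2 : 1 - y * (1 - b * (1 - y)) = (1 - y) * (1 + b * y) := by ring
    have p1 : 0 < 1 - b * (1 - y) := by nlinarith
    have p2 : 0 < 1 + b * y := by positivity
    have key : Real.log ((1 + b) * (1 - b * (1 - y))) ≤ Real.log (1 + b * y) :=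
      Real.log_le_log (by positivity) (by nlinarith [mul_pos (mul_pos hb0 hb0) hy'])
    rw [Real.log_mul (by positivity) p1.ne'] at key
    rw [e1, e2, Real.log_mul h0.ne' p1.ne', Real.log_mul hy'.ne' p2.ne']
    linarith

variable (ha : a ∈ Ioo (0 : ℝ) (1 / 2)) (hb : b ∈ Ioo (0 : ℝ) (1 / 2))

theorem iterate_skewMap_fst (n : ℕ) (p : Square) :
    ((skewMap a b ha hb)^[n] p).1.1 = doubling^[n] p.1.1 := by
  have h : Function.Semiconj (fun p : Square => p.1.1) (skewMap a b ha hb) doubling := fun _ => rfl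
  exact (h.iterate_right n).eq p

theorem iterate_skewMap_succ_snd (n : ℕ) (p : Square) :
    ((skewMap a b ha hb)^[n + 1] p).1.2
      = fibre a b (doubling^[n] p.1.1) ((skewMap a b ha hb)^[n] p).1.2 := by
  rw [Function.iterate_succ_apply', ← iterate_skewMap_fst ha hb]
  rfl

theorem iterate_skewMap_mem_Ioo {p : Square} (hp : p.1.2 ∈ Ioo (0 : ℝ) 1) (n : ℕ) :
    ((skewMap a b ha hb)^[n] p).1.2 ∈ Ioo (0 : ℝ) 1 := by
  induction n with
  | zero => exact hp
  | succ n ih =>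
    rw [iterate_skewMap_succ_snd]
    exact fibre_mem_Ioo ha hb _ ih

theorem le_logit_iterate {p : Square} (hp : p.1.2 ∈ Ioo (0 : ℝ) 1) (n : ℕ) :
    logit p.1.2 + (∑ i ∈ Finset.range n,
        if doubling^[i] p.1.1 < 1 / 2 then Real.log (1 + a) else Real.log (1 - b)) ≤
      logit ((skewMap a b ha hb)^[n] p).1.2 := by
  induction n with
  | zero => simp
  | succ n ih =>
    rw [Finset.sum_range_succ, ← add_assoc, iterate_skewMap_succ_snd]
    exact (add_le_add_left ih _).trans
      (le_logit_fibre ha hb _ (iterate_skewMap_mem_Ioo ha hb hp n))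

theorem logit_iterate_le {p : Square} (hp : p.1.2 ∈ Ioo (0 : ℝ) 1) (n : ℕ) :
    logit ((skewMap a b ha hb)^[n] p).1.2 ≤
      logit p.1.2 + ∑ i ∈ Finset.range n,
        if doubling^[i] p.1.1 < 1 / 2 then -Real.log (1 - a) else -Real.log (1 + b) := by
  induction n with
  | zero => simp
  | succ n ih =>
    rw [Finset.sum_range_succ, ← add_assoc, iterate_skewMap_succ_snd]
    exact (logit_fibre_le ha hb _ (iterate_skewMap_mem_Ioo ha hb hp n)).trans
      (add_le_add_left ih _)

/-! ### Limit sets of almost every point -/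

/-- An orbit whose base orbit is dense and whose height converges accumulates on a full edge. -/
theorem omegaSet_eq_edge {p : Square} {c : ℝ}
    (hx : ∀ z ∈ Icc (0 : ℝ) 1, MapClusterPt z atTop fun n => doubling^[n] p.1.1)
    (hy : Tendsto (fun n => ((skewMap a b ha hb)^[n] p).1.2) atTop (𝓝 c)) :
    omegaSet (skewMap a b ha hb) p = edge c := by
  ext q
  rw [mem_omegaSet_iff, mapClusterPt_iff_ultrafilter]
  constructor
  · rintro ⟨U, hU, hq⟩
    have h1 : Tendsto (fun n => ((skewMap a b ha hb)^[n] p).1.2) U (𝓝 q.1.2) :=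
      ((continuous_snd.comp continuous_subtype_val).tendsto q).comp hq
    exact tendsto_nhds_unique h1 (hy.mono_left hU)
  · intro (hq : q.1.2 = c)
    obtain ⟨U, hU, hUx⟩ := mapClusterPt_iff_ultrafilter.1 (hx q.1.1 q.2.1)
    refine ⟨U, hU, ?_⟩
    rw [tendsto_subtype_rng, Prod.tendsto_iff]
    refine ⟨?_, ?_⟩
    · simpa only [iterate_skewMap_fst] using hUx
    · rw [hq]
      exact hy.mono_left hU

theorem ae_omegaSet_eq_topEdge (h : b < a / (1 + a)) :
    ∀ᵐ p ∂lebesgue, omegaSet (skewMap a b ha hb) p = topEdge := by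
  have hb' : 0 < 1 - b := by linarith [hb.2]
  have ha' : 0 < 1 + a := by linarith [ha.1]
  have hdrift : 0 < Real.log (1 + a) + Real.log (1 - b) := by
    rw [← Real.log_mul ha'.ne' hb'.ne']
    apply Real.log_pos
    rw [lt_div_iff₀ ha'] at h
    linarith
  filter_upwards [ae_lebesgue_of_ae_unitVolume
    (ae_mapClusterPt_doubling.and (ae_tendsto_sum_atTop hdrift))] with p ⟨⟨hx, hs⟩, hp⟩
  refine omegaSet_eq_edge ha hb hx ?_
  have h1 := tendsto_atTop_mono (le_logit_iterate ha hb hp) (tendsto_atTop_add_const_left _ _ hs)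
  exact (Real.tendsto_sigmoid_atTop.comp h1).congr fun n =>
    sigmoid_logit (iterate_skewMap_mem_Ioo ha hb hp n)

theorem ae_omegaSet_eq_bottomEdge (h : a / (1 - a) < b) :
    ∀ᵐ p ∂lebesgue, omegaSet (skewMap a b ha hb) p = bottomEdge := by
  have ha' : 0 < 1 - a := by linarith [ha.2]
  have hb' : 0 < 1 + b := by linarith [hb.1]
  have hdrift : 0 < Real.log (1 - a) + Real.log (1 + b) := by
    rw [← Real.log_mul ha'.ne' hb'.ne']
    apply Real.log_pos
    rw [div_lt_iff₀ ha'] at h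
    linarith
  filter_upwards [ae_lebesgue_of_ae_unitVolume
    (ae_mapClusterPt_doubling.and (ae_tendsto_sum_atTop hdrift))] with p ⟨⟨hx, hs⟩, hp⟩
  refine omegaSet_eq_edge ha hb hx ?_
  have hs' : Tendsto (fun n => ∑ i ∈ Finset.range n,
      if doubling^[i] p.1.1 < 1 / 2 then -Real.log (1 - a) else -Real.log (1 + b))
      atTop atBot := by
    refine (tendsto_neg_atTop_atBot.comp hs).congr fun n => ?_
    simp only [Function.comp_apply, ← Finset.sum_neg_distrib, neg_ite]
  have h1 := tendsto_atBot_mono (logit_iterate_le ha hb hp) (tendsto_atBot_add_const_left _ _ hs')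
  exact (Real.tendsto_sigmoid_atBot.comp h1).congr fun n =>
    sigmoid_logit (iterate_skewMap_mem_Ioo ha hb hp n)

/-! ### The edges as invariant sets -/

theorem fibre_edge {c : ℝ} (hc : c = 0 ∨ c = 1) (x : ℝ) : fibre a b x c = c := by
  rcases hc with rfl | rfl <;> simp [fibre]

theorem iterate_skewMap_snd_edge {c : ℝ} (hc : c = 0 ∨ c = 1) {p : Square} (hp : p.1.2 = c)
    (n : ℕ) : ((skewMap a b ha hb)^[n] p).1.2 = c := by
  induction n with
  | zero => exact hp
  | succ n ih => rw [iterate_skewMap_succ_snd, ih, fibre_edge hc]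

theorem mem_Icc_of_edge {c : ℝ} (hc : c = 0 ∨ c = 1) : c ∈ Icc (0 : ℝ) 1 := by
  rcases hc with rfl | rfl <;> simp

theorem isCompactInvariant_edge {c : ℝ} (hc : c = 0 ∨ c = 1) :
    IsCompactInvariant (skewMap a b ha hb) (edge c) := by
  refine ⟨(isClosed_edge c).isCompact, Subset.antisymm ?_ ?_⟩
  · rintro _ ⟨p, hp, rfl⟩
    exact iterate_skewMap_snd_edge ha hb hc hp 1
  · rintro ⟨⟨x, y⟩, hx, hy⟩ (rfl : y = c)
    -- The right branch maps onto the closed interval, the left one misses `1`.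
    have hx' : (x + 1) / 2 ∈ Icc (0 : ℝ) 1 := ⟨by linarith [hx.1], by linarith [hx.2]⟩
    refine ⟨⟨((x + 1) / 2, y), hx', hy⟩, rfl, Subtype.ext (Prod.ext ?_ (fibre_edge hc _))⟩
    change doubling ((x + 1) / 2) = x
    rw [doubling, if_neg (by linarith [hx.1])]
    ring

theorem isTransitiveSet_edge {c : ℝ} (hc : c = 0 ∨ c = 1) :
    IsTransitiveSet (skewMap a b ha hb) (edge c) := by
  obtain ⟨x, hx, hxI⟩ := (ae_mapClusterPt_doubling.and (ae_restrict_mem measurableSet_Icc)).exists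
  refine ⟨⟨(x, c), hxI, mem_Icc_of_edge hc⟩, rfl, omegaSet_eq_edge ha hb hx ?_⟩
  exact tendsto_const_nhds.congr fun n => (iterate_skewMap_snd_edge ha hb hc rfl n).symm

theorem isChaoticSaddle_edge {c : ℝ} (hc : c = 0 ∨ c = 1)
    (h : lebesgue (basin (skewMap a b ha hb) (edge c)) = 0) :
    IsChaoticSaddle (skewMap a b ha hb) lebesgue (edge c) := by
  refine ⟨isCompactInvariant_edge ha hb hc, isTransitiveSet_edge ha hb hc,
    ⟨univ, isOpen_univ, subset_univ _, ?_⟩, h⟩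
  obtain ⟨p, -, hp⟩ := isTransitiveSet_edge ha hb hc
  exact ⟨p, hp.subset, trivial⟩

end Edges

/-! ### Lyapunov exponents -/

section Lyapunov

variable {a b : ℝ} (ha : a ∈ Ioo (0 : ℝ) (1 / 2)) (hb : b ∈ Ioo (0 : ℝ) (1 / 2))

theorem planar_coe (G : Square → Square) (p : Square) : planar G (p : ℝ × ℝ) = G p :=
  Subtype.val_injective.extend_apply _ _ p

theorem uniqueDiffOn_unitSquare : UniqueDiffOn ℝ unitSquare :=
  (uniqueDiffOn_Icc zero_lt_one).prod (uniqueDiffOn_Icc zero_lt_one)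

theorem exists_hasFDerivAt_branch (d s : ℝ) (p : ℝ × ℝ) : ∃ D : ℝ × ℝ →L[ℝ] ℝ × ℝ,
    (∀ t, D (t, 0) = (2 * t, 0)) ∧
      HasFDerivAt (fun q : ℝ × ℝ => (2 * q.1 - d, q.2 + s * q.2 * (1 - q.2))) D p := by
  have h1 : HasFDerivAt (fun q : ℝ × ℝ => 2 * q.1 - d) _ p :=
    ((hasFDerivAt_fst (𝕜 := ℝ) (p := p)).const_mul (2 : ℝ)).sub_const d
  have h : DifferentiableAt ℝ (fun y : ℝ => y + s * y * (1 - y)) p.2 := by fun_prop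
  have h2 : HasFDerivAt (fun q : ℝ × ℝ => q.2 + s * q.2 * (1 - q.2)) _ p :=
    h.hasDerivAt.comp_hasFDerivAt p (hasFDerivAt_snd (𝕜 := ℝ) (p := p))
  exact ⟨_, fun t => by simp, h1.prodMk h2⟩

theorem exists_hasFDerivWithinAt_planar {p : Square} (hp : p.1.1 ≠ 1 / 2) :
    ∃ D : ℝ × ℝ →L[ℝ] ℝ × ℝ, (∀ t, D (t, 0) = (2 * t, 0)) ∧
      HasFDerivWithinAt (planar (skewMap a b ha hb)) D unitSquare (p : ℝ × ℝ) := by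
  have heq : ∀ q : ℝ × ℝ, q ∈ unitSquare →
      planar (skewMap a b ha hb) q = (doubling q.1, fibre a b q.1 q.2) :=
    fun q hq => planar_coe _ ⟨q, hq⟩
  rcases lt_or_gt_of_ne hp with h | h
  · obtain ⟨D, hD, hd⟩ := exists_hasFDerivAt_branch 0 a p.1
    refine ⟨D, hD, hd.hasFDerivWithinAt.congr_of_eventuallyEq ?_ ?_⟩
    · filter_upwards [self_mem_nhdsWithin,
        mem_nhdsWithin_of_mem_nhds (continuous_fst.continuousAt.eventually_lt_const h)] with q hq hlt
      rw [heq q hq, doubling, fibre, if_pos hlt, if_pos hlt, sub_zero]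
    · rw [heq _ p.2, doubling, fibre, if_pos h, if_pos h, sub_zero]
  · obtain ⟨D, hD, hd⟩ := exists_hasFDerivAt_branch 1 (-b) p.1
    refine ⟨D, hD, hd.hasFDerivWithinAt.congr_of_eventuallyEq ?_ ?_⟩
    · filter_upwards [self_mem_nhdsWithin,
        mem_nhdsWithin_of_mem_nhds (continuous_fst.continuousAt.eventually_const_lt h)] with q hq hlt
      rw [heq q hq, doubling, fibre, if_neg (not_lt.2 (le_of_lt hlt)),
        if_neg (not_lt.2 (le_of_lt hlt))]
      ring_nf
    · rw [heq _ p.2, doubling, fibre, if_neg (not_lt.2 h.le), if_neg (not_lt.2 h.le)]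
      ring_nf

/-- Along an orbit that avoids the discontinuity, every iterate is differentiable and its
derivative stretches horizontal vectors by a factor `2 ^ n`. -/
theorem exists_hasFDerivWithinAt_planar_iterate {p : Square}
    (hp : ∀ n, doubling^[n] p.1.1 ≠ 1 / 2) (n : ℕ) :
    ∃ D : ℝ × ℝ →L[ℝ] ℝ × ℝ, D (1, 0) = (2 ^ n, 0) ∧
      HasFDerivWithinAt (planar (skewMap a b ha hb)^[n]) D unitSquare (p : ℝ × ℝ) := by
  induction n with
  | zero =>
    refine ⟨ContinuousLinearMap.id ℝ _, by simp, ?_⟩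
    exact (hasFDerivWithinAt_id _ _).congr (fun q hq => planar_coe id ⟨q, hq⟩) (planar_coe id p)
  | succ n ih =>
    obtain ⟨D, hD, hd⟩ := ih
    obtain ⟨D', hD', hd'⟩ := exists_hasFDerivWithinAt_planar ha hb
      (p := (skewMap a b ha hb)^[n] p) (by rw [iterate_skewMap_fst]; exact hp n)
    rw [← planar_coe] at hd'
    have hmaps : MapsTo (planar (skewMap a b ha hb)^[n]) unitSquare unitSquare := by
      intro q hq
      rw [planar_coe _ ⟨q, hq⟩]
      exact Subtype.coe_prop _
    have heq (q : Square) : planar (skewMap a b ha hb)^[n + 1] (q : ℝ × ℝ)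
        = (planar (skewMap a b ha hb) ∘ planar (skewMap a b ha hb)^[n]) q := by
      rw [Function.comp_apply, planar_coe, planar_coe, planar_coe, Function.iterate_succ_apply']
    refine ⟨D'.comp D, ?_, (hd'.comp _ hd hmaps).congr (fun q hq => heq ⟨q, hq⟩) (heq p)⟩
    rw [ContinuousLinearMap.comp_apply, hD, hD', pow_succ']

theorem hasLyapunovExponent_log_two {p : Square} (hp : ∀ n, doubling^[n] p.1.1 ≠ 1 / 2) :
    HasLyapunovExponent (skewMap a b ha hb) p (1, 0) (Real.log 2) := by
  refine ⟨fun n => ?_, ?_⟩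
  · obtain ⟨D, -, hd⟩ := exists_hasFDerivWithinAt_planar_iterate ha hb hp n
    exact hd.differentiableWithinAt
  · refine tendsto_const_nhds.congr' ?_
    filter_upwards [eventually_gt_atTop 0] with n hn
    obtain ⟨D, hD, hd⟩ := exists_hasFDerivWithinAt_planar_iterate ha hb hp n
    have hn' : (n : ℝ) ≠ 0 := by positivity
    have hnorm : ‖((2 : ℝ) ^ n, (0 : ℝ))‖ = 2 ^ n := by simp [Prod.norm_def]
    rw [hd.fderivWithin (uniqueDiffOn_unitSquare _ p.2), hD, hnorm, Real.log_pow]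
    field_simp

theorem measurable_skewMap : Measurable (skewMap a b ha hb) := by
  refine Measurable.subtype_mk (Measurable.prodMk
    (measurable_doubling.comp (measurable_fst.comp measurable_subtype_coe)) ?_)
  exact Measurable.ite (measurable_fst.comp measurable_subtype_coe measurableSet_Iio)
    (by fun_prop) (by fun_prop)

/-! ### Ergodic measures on the edges -/

variable {c : ℝ}

/-- The parametrization of an edge by the circle. -/
noncomputable def edgePoint (hc : c = 0 ∨ c = 1) (t : UnitAddCircle) : Square :=
  ⟨(circleRep t, c), Ico_subset_Icc_self (circleRep_mem_Ico t), mem_Icc_of_edge hc⟩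

/-- Lebesgue measure on an edge. -/
noncomputable def edgeMeasure (hc : c = 0 ∨ c = 1) : Measure Square :=
  Measure.map (edgePoint hc) volume

theorem measurable_edgePoint (hc : c = 0 ∨ c = 1) : Measurable (edgePoint hc) :=
  (measurePreserving_circleRep.measurable.prodMk measurable_const).subtype_mk

theorem isErgodicOn_edgeMeasure (hc : c = 0 ∨ c = 1) :
    IsErgodicOn (skewMap a b ha hb) (edge c) (edgeMeasure hc) := by
  have hj := measurable_edgePoint hc
  refine ⟨⟨?_⟩, ?_, ?_⟩
  · rw [edgeMeasure, Measure.map_apply hj MeasurableSet.univ, preimage_univ,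
      UnitAddCircle.measure_univ]
  · refine (MeasurePreserving.mk hj rfl).ergodic_of_ergodic_semiconj
      (AddCircle.ergodic_nsmul one_lt_two) (measurable_skewMap ha hb) fun t => ?_
    exact Subtype.ext (Prod.ext (semiconj_circleRep t) (fibre_edge hc _).symm)
  · rw [edgeMeasure, Measure.map_apply hj (isClosed_edge c).measurableSet.compl]
    refine (congrArg _ (eq_empty_of_forall_notMem fun t => ?_)).trans measure_empty
    exact notMem_compl_iff.2 rfl

theorem measurePreserving_fst_edgeMeasure (hc : c = 0 ∨ c = 1) :
    MeasurePreserving (fun p : Square => p.1.1) (edgeMeasure hc) unitVolume := by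
  have hm : Measurable fun p : Square => p.1.1 := measurable_fst.comp measurable_subtype_coe
  refine ⟨hm, ?_⟩
  rw [edgeMeasure, Measure.map_map hm (measurable_edgePoint hc)]
  exact measurePreserving_circleRep.map_eq

theorem edgeMeasure_pos (hc : c = 0 ∨ c = 1) {U : Set Square} (hU : IsOpen U)
    (h : (edge c ∩ U).Nonempty) : 0 < edgeMeasure hc U := by
  obtain ⟨V, hV, rfl⟩ := isOpen_induced_iff.1 hU
  obtain ⟨p, hp, hpV⟩ := h
  have hW : IsOpen {x : ℝ | (x, c) ∈ V} := hV.preimage (by fun_prop)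
  have hxW : (p.1.1, c) ∈ V := by
    rw [← show p.1.2 = c from hp]
    exact hpV
  rw [edgeMeasure, Measure.map_apply (measurable_edgePoint hc) hU.measurableSet]
  change 0 < volume (circleRep ⁻¹' {x : ℝ | (x, c) ∈ V})
  rw [measurePreserving_circleRep.measure_preimage hW.measurableSet.nullMeasurableSet]
  exact unitVolume_pos_of_isOpen hW p.2.1 hxW

theorem isErgodicOn_dirac {M : Type*} [MetricSpace M] [MeasurableSpace M]
    [MeasurableSingletonClass M] {F : M → M} (hF : Measurable F) {A : Set M} {p : M} (hp : p ∈ A)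
    (hfix : F p = p) : IsErgodicOn F A (Measure.dirac p) := by
  refine ⟨inferInstance, ⟨⟨hF, by rw [Measure.map_dirac' hF, hfix]⟩, ⟨fun s _ _ => ?_⟩⟩, ?_⟩
  · rw [ae_dirac_eq, eventuallyConst_set]
    exact (em (p ∈ s)).imp (fun h => h) fun h => h
  · rw [Measure.dirac_apply, indicator_of_notMem (notMem_compl_iff.2 hp)]

theorem ae_forall_iterate_doubling_ne : ∀ᵐ x ∂unitVolume, ∀ n, doubling^[n] x ≠ 1 / 2 := by
  have h : ∀ᵐ x ∂unitVolume, x ≠ 1 / 2 := ae_restrict_of_ae (by simp [ae_iff])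
  exact ae_all_iff.2 fun n =>
    (ergodic_doubling.toMeasurePreserving.iterate n).quasiMeasurePreserving.ae h

theorem isChaoticAttractor_edge (hc : c = 0 ∨ c = 1)
    (h : ∀ᵐ p ∂lebesgue, omegaSet (skewMap a b ha hb) p = edge c) :
    IsChaoticAttractor (skewMap a b ha hb) lebesgue (edge c) := by
  refine ⟨isMilnorAttractor_of_ae_omegaSet_eq (isCompactInvariant_edge ha hb hc) lebesgue_ne_zero h,
    isTransitiveSet_edge ha hb hc, edgeMeasure hc, isErgodicOn_edgeMeasure ha hb hc,
    fun U hU hne => edgeMeasure_pos hc hU hne, ?_, Real.log 2, Real.log_pos one_lt_two, ?_⟩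
  · let p : Square := ⟨(0, c), by simp, mem_Icc_of_edge hc⟩
    have hfix : skewMap a b ha hb p = p :=
      Subtype.ext (Prod.ext (by simp [skewMap, doubling, p]) (fibre_edge hc _))
    refine ⟨Measure.dirac p, isErgodicOn_dirac (measurable_skewMap ha hb) rfl hfix, fun heq => ?_⟩
    -- The point mass at the fixed endpoint does not charge the rest of the edge.
    have hU : IsOpen {q : Square | 0 < q.1.1} :=
      isOpen_lt continuous_const (continuous_fst.comp continuous_subtype_val)
    have hpos := edgeMeasure_pos hc hU
      ⟨⟨(1, c), by simp, mem_Icc_of_edge hc⟩, rfl, one_pos (α := ℝ)⟩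
    have hp : p ∉ {q : Square | 0 < q.1.1} := lt_irrefl (0 : ℝ)
    rw [← heq, Measure.dirac_apply, indicator_of_notMem hp] at hpos
    exact lt_irrefl _ hpos
  · filter_upwards [(measurePreserving_fst_edgeMeasure hc).quasiMeasurePreserving.ae
      ae_forall_iterate_doubling_ne] with p hp
    exact ⟨(1, 0), hasLyapunovExponent_log_two ha hb hp⟩

end Lyapunov

/-! ### Runs of equal binary digits -/

theorem two_pow_mul_lt_half {M j : ℕ} (hj : j < M) {t : ℝ} (h0 : 0 < t) (ht : t < 1 / 2 ^ M) :
    2 ^ j * t < 1 / 2 := by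
  have h1 : (2 : ℝ) ^ (j + 1) ≤ 2 ^ M := pow_le_pow_right₀ one_le_two hj
  have h2 : t * 2 ^ M < 1 := (lt_div_iff₀ (by positivity)).1 ht
  rw [pow_succ] at h1
  nlinarith

theorem iterate_doubling_lt_half {M : ℕ} {z : ℝ} (hz : z ∈ Ioo (0 : ℝ) (1 / 2 ^ M)) {j : ℕ}
    (hj : j < M) : doubling^[j] z < 1 / 2 := by
  have key : ∀ i ≤ M, doubling^[i] z = 2 ^ i * z := by
    intro i hi
    induction i with
    | zero => simp
    | succ i ih =>
      rw [Function.iterate_succ_apply', ih (by omega), doubling,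
        if_pos (two_pow_mul_lt_half hi hz.1 hz.2)]
      ring
  rw [key j hj.le]
  exact two_pow_mul_lt_half hj hz.1 hz.2

theorem half_le_iterate_doubling {M : ℕ} {z : ℝ} (hz : z ∈ Ioo (1 - 1 / 2 ^ M : ℝ) 1) {j : ℕ}
    (hj : j < M) : 1 / 2 ≤ doubling^[j] z := by
  have hlt {i : ℕ} (hi : i < M) : 2 ^ i * (1 - z) < 1 / 2 :=
    two_pow_mul_lt_half hi (by linarith [hz.2]) (by linarith [hz.1])
  have key : ∀ i ≤ M, doubling^[i] z = 1 - 2 ^ i * (1 - z) := by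
    intro i hi
    induction i with
    | zero => simp
    | succ i ih =>
      rw [Function.iterate_succ_apply', ih (by omega), doubling,
        if_neg (by linarith [hlt hi])]
      ring
  rw [key j hj.le]
  linarith [hlt hj]

/-- Every ball centred in the unit interval contains a dyadic interval, which an iterate of the
doubling map sends affinely onto `(0,1)`; the preimage of `(u,v)` in it is the interval `(l,r)`. -/
theorem exists_dyadic_Ioo {x₀ ε : ℝ} (hx₀ : x₀ ∈ Icc (0 : ℝ) 1) (hε : 0 < ε) :
    ∃ N : ℕ, ∀ u v : ℝ, 0 ≤ u → u < v → v ≤ 1 → ∃ l r : ℝ, l < r ∧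
      Ioo l r ⊆ Ioo 0 1 ∩ Metric.ball x₀ ε ∧ ∀ x ∈ Ioo l r, doubling^[N] x ∈ Ioo u v := by
  -- The endpoint `1` lies in no cell `[k/2^N, (k+1)/2^N)` of the unit interval, so the centre is
  -- first moved into the open interval.
  obtain ⟨x₁, hx₁, hd⟩ : ∃ x₁ ∈ Ioo (0 : ℝ) 1, dist x₀ x₁ < ε / 2 :=
    Metric.mem_closure_iff.1 (by rwa [closure_Ioo zero_ne_one]) _ (half_pos hε)
  rw [Real.dist_eq, abs_lt] at hd
  obtain ⟨N, hN⟩ := exists_pow_lt_of_lt_one (half_pos hε) (one_half_lt_one (α := ℝ))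
  rw [one_div, inv_pow] at hN
  have h2 : (0 : ℝ) < 2 ^ N := by positivity
  have hε2 : 1 < ε / 2 * 2 ^ N := (inv_lt_iff_one_lt_mul₀ h2).1 hN
  set k : ℤ := ⌊(2 : ℝ) ^ N * x₁⌋
  have hk0 : (0 : ℝ) ≤ k := by exact_mod_cast Int.floor_nonneg.2 (by have := hx₁.1; positivity)
  have hk1 : (k : ℝ) + 1 ≤ 2 ^ N := by
    have : k < 2 ^ N := Int.floor_lt.2 (by push_cast; nlinarith [hx₁.2])
    exact_mod_cast this
  have hkl : (k : ℝ) ≤ 2 ^ N * x₁ := Int.floor_le _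
  have hkr : 2 ^ N * x₁ < k + 1 := Int.lt_floor_add_one _
  refine ⟨N, fun u v hu huv hv => ⟨(k + u) / 2 ^ N, (k + v) / 2 ^ N, by gcongr, ?_, ?_⟩⟩
  · rintro x ⟨hl, hr⟩
    rw [div_lt_iff₀ h2] at hl
    rw [lt_div_iff₀ h2] at hr
    refine ⟨⟨by nlinarith, by nlinarith⟩, ?_⟩
    rw [Metric.mem_ball, Real.dist_eq, abs_lt]
    constructor <;> nlinarith
  · rintro x ⟨hl, hr⟩
    rw [div_lt_iff₀ h2] at hl
    rw [lt_div_iff₀ h2] at hr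
    have hx : x ∈ Ico (0 : ℝ) 1 := ⟨by nlinarith, by nlinarith⟩
    have hf : Int.fract ((2 : ℝ) ^ N * x) = 2 ^ N * x - k := by
      rw [Int.fract_eq_iff]
      exact ⟨by linarith, by linarith, k, by ring⟩
    rw [iterate_doubling_eq_fract hx, hf]
    exact ⟨by linarith, by linarith⟩

/-! ### Riddled basins -/

section Riddling

variable {a b : ℝ} (ha : a ∈ Ioo (0 : ℝ) (1 / 2)) (hb : b ∈ Ioo (0 : ℝ) (1 / 2))

/-- A criterion for a riddled basin: arbitrarily close to the edge and for every `N` there is a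
horizontal strip whose points leave `U` as soon as the `N`-th iterate of the base point lies in a
suitable interval. -/
theorem hasLocallyRiddledBasin_edge {c : ℝ} {U : Set Square} (hU : IsOpen U) (hcU : edge c ⊆ U)
    (h : ∀ N : ℕ, ∀ ε > 0, ∃ u v l r : ℝ, 0 ≤ u ∧ u < v ∧ v ≤ 1 ∧ l < r ∧
      Ioo l r ⊆ Ioo 0 1 ∩ Metric.ball c ε ∧ ∀ p : Square, p.1.2 ∈ Ioo l r →
        doubling^[N] p.1.1 ∈ Ioo u v → ∃ n, (skewMap a b ha hb)^[n] p ∉ U) :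
    HasLocallyRiddledBasin (skewMap a b ha hb) lebesgue (edge c) := by
  refine ⟨U, hU, hcU, fun q (hq : q.1.2 = c) ε hε => ?_⟩
  obtain ⟨N, hN⟩ := exists_dyadic_Ioo q.2.1 hε
  obtain ⟨u, v, l, r, hu, huv, hv, hlr, hsub, hleave⟩ := h N ε hε
  obtain ⟨l', r', hlr', hsub', hmaps⟩ := hN u v hu huv hv
  refine (lebesgue_pos_of_Ioo hlr' hlr (fun x hx => (hsub' hx).1)
    fun y hy => (hsub hy).1).trans_le (measure_mono ?_)
  rintro p ⟨hx, hy⟩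
  refine ⟨?_, ?_⟩
  · rw [Metric.mem_ball, Subtype.dist_eq, Prod.dist_eq, hq]
    exact max_lt (hsub' hx).2 (hsub hy).2
  · obtain ⟨n, hn⟩ := hleave p hy (hmaps _ hx)
    exact fun hmem => hn (mem_iInter.1 hmem n)

theorem sum_range_add_ge {φ : ℕ → ℝ} {A B : ℝ} {N M : ℕ} (hA : ∀ i, A ≤ φ i)
    (hB : ∀ j < M, B ≤ φ (N + j)) : N * A + M * B ≤ ∑ i ∈ Finset.range (N + M), φ i := by
  rw [Finset.sum_range_add]
  refine add_le_add ?_ ?_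
  · simpa using Finset.card_nsmul_le_sum (Finset.range N) φ A fun i _ => hA i
  · simpa using Finset.card_nsmul_le_sum (Finset.range M) (fun j => φ (N + j)) B
      fun j hj => hB j (Finset.mem_range.1 hj)

/-- Near the bottom edge, a long run of digits `0` lifts points above height `1/2`. -/
theorem hasLocallyRiddledBasin_bottomEdge :
    HasLocallyRiddledBasin (skewMap a b ha hb) lebesgue bottomEdge := by
  have hlog : 0 < Real.log (1 + a) := Real.log_pos (by linarith [ha.1])
  have hlog' : Real.log (1 - b) ≤ 0 :=
    Real.log_nonpos (by linarith [hb.2]) (by linarith [hb.1])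
  refine hasLocallyRiddledBasin_edge ha hb (c := 0) (U := {p | p.1.2 < 1 / 2})
    (isOpen_lt (continuous_snd.comp continuous_subtype_val) continuous_const) ?_ ?_
  · intro p (hp : p.1.2 = 0)
    change p.1.2 < 1 / 2
    rw [hp]
    norm_num
  intro N ε hε
  have hδ : 0 < min ε 1 := lt_min hε one_pos
  set δ := min ε 1
  have hδε : δ ≤ ε := min_le_left _ _
  have hδ1 : δ ≤ 1 := min_le_right _ _
  -- `M` digits `0` outweigh the loss of height during the first `N` steps.
  obtain ⟨M, hM⟩ := Archimedean.arch (-(logit (δ / 2) + N * Real.log (1 - b))) hlog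
  rw [nsmul_eq_mul] at hM
  refine ⟨0, 1 / 2 ^ M, δ / 2, δ, le_rfl, by positivity, ?_, by linarith, ?_, ?_⟩
  · rw [div_le_one (by positivity)]
    exact one_le_pow₀ one_le_two
  · rintro y ⟨hl, hr⟩
    refine ⟨⟨by linarith, by linarith⟩, ?_⟩
    rw [Metric.mem_ball, Real.dist_eq, abs_lt]
    constructor <;> linarith
  · intro p hp hx
    have hp' : p.1.2 ∈ Ioo (0 : ℝ) 1 := ⟨by linarith [hp.1], by linarith [hp.2]⟩
    have hs := sum_range_add_ge (N := N) (M := M) (A := Real.log (1 - b)) (B := Real.log (1 + a))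
      (φ := fun i => if doubling^[i] p.1.1 < 1 / 2 then Real.log (1 + a) else Real.log (1 - b))
      (fun i => by split_ifs <;> linarith) (fun j hj => by
        rw [add_comm N j, Function.iterate_add_apply, if_pos (iterate_doubling_lt_half hx hj)])
    have h1 := le_logit_iterate ha hb hp' (N + M)
    have h2 := logit_le_logit ⟨by linarith, by linarith⟩ hp' hp.1.le
    refine ⟨N + M, fun (hlt : ((skewMap a b ha hb)^[N + M] p).1.2 < 1 / 2) => not_le_of_gt hlt ?_⟩
    rw [← sigmoid_logit (iterate_skewMap_mem_Ioo ha hb hp' (N + M)), one_div, ← Real.sigmoid_zero]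
    exact Real.sigmoid_le (by linarith)

/-- Near the top edge, a long run of digits `1` pushes points below height `1/2`. -/
theorem hasLocallyRiddledBasin_topEdge :
    HasLocallyRiddledBasin (skewMap a b ha hb) lebesgue topEdge := by
  have hlog : 0 < Real.log (1 + b) := Real.log_pos (by linarith [hb.1])
  have hlog' : Real.log (1 - a) ≤ 0 :=
    Real.log_nonpos (by linarith [ha.2]) (by linarith [ha.1])
  refine hasLocallyRiddledBasin_edge ha hb (c := 1) (U := {p | 1 / 2 < p.1.2})
    (isOpen_lt continuous_const (continuous_snd.comp continuous_subtype_val)) ?_ ?_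
  · intro p (hp : p.1.2 = 1)
    change 1 / 2 < p.1.2
    rw [hp]
    norm_num
  intro N ε hε
  have hδ : 0 < min ε 1 := lt_min hε one_pos
  set δ := min ε 1
  have hδε : δ ≤ ε := min_le_left _ _
  have hδ1 : δ ≤ 1 := min_le_right _ _
  -- `M` digits `1` outweigh the gain of height during the first `N` steps.
  obtain ⟨M, hM⟩ := Archimedean.arch (logit (1 - δ / 2) - N * Real.log (1 - a)) hlog
  rw [nsmul_eq_mul] at hM
  refine ⟨1 - 1 / 2 ^ M, 1, 1 - δ, 1 - δ / 2, ?_, ?_, le_rfl, by linarith, ?_, ?_⟩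
  · rw [sub_nonneg, div_le_one (by positivity)]
    exact one_le_pow₀ one_le_two
  · exact sub_lt_self _ (by positivity)
  · rintro y ⟨hl, hr⟩
    refine ⟨⟨by linarith, by linarith⟩, ?_⟩
    rw [Metric.mem_ball, Real.dist_eq, abs_lt]
    constructor <;> linarith
  · intro p hp hx
    have hp' : p.1.2 ∈ Ioo (0 : ℝ) 1 := ⟨by linarith [hp.1], by linarith [hp.2]⟩
    have hs := sum_range_add_ge (N := N) (M := M) (A := Real.log (1 - a)) (B := Real.log (1 + b))
      (φ := fun i => -if doubling^[i] p.1.1 < 1 / 2 then -Real.log (1 - a) else -Real.log (1 + b))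
      (fun i => by split_ifs <;> linarith) (fun j hj => by
        rw [add_comm N j, Function.iterate_add_apply,
          if_neg (not_lt.2 (half_le_iterate_doubling hx hj)), neg_neg])
    rw [Finset.sum_neg_distrib] at hs
    have h1 := logit_iterate_le ha hb hp' (N + M)
    have h2 := logit_le_logit hp' ⟨by linarith, by linarith⟩ hp.2.le
    refine ⟨N + M, fun (hlt : 1 / 2 < ((skewMap a b ha hb)^[N + M] p).1.2) => not_le_of_gt hlt ?_⟩
    rw [← sigmoid_logit (iterate_skewMap_mem_Ioo ha hb hp' (N + M)), one_div, ← Real.sigmoid_zero]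
    exact Real.sigmoid_le (by linarith)

end Riddling

theorem not_topEdge_subset_bottomEdge : ¬ topEdge ⊆ bottomEdge := fun h =>
  zero_ne_one (h (show (⟨(0, 1), by simp, by simp⟩ : Square) ∈ topEdge from rfl)).symm

theorem not_bottomEdge_subset_topEdge : ¬ bottomEdge ⊆ topEdge := fun h =>
  zero_ne_one (h (show (⟨(0, 0), by simp, by simp⟩ : Square) ∈ bottomEdge from rfl))

end RiddledSkew

theorem mainTheorem4 (a b : ℝ) (ha : a ∈ Set.Ioo (0 : ℝ) (1 / 2))
    (hb : b ∈ Set.Ioo (0 : ℝ) (1 / 2)) :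
    (b < a / (1 + a) →
      RiddledSkew.IsChaoticSaddle (RiddledSkew.skewMap a b ha hb)
        RiddledSkew.lebesgue RiddledSkew.bottomEdge ∧
      RiddledSkew.IsChaoticAttractor (RiddledSkew.skewMap a b ha hb)
        RiddledSkew.lebesgue RiddledSkew.topEdge ∧
      RiddledSkew.HasLocallyRiddledBasin (RiddledSkew.skewMap a b ha hb)
        RiddledSkew.lebesgue RiddledSkew.topEdge) ∧
    (a / (1 - a) < b →
      RiddledSkew.IsChaoticSaddle (RiddledSkew.skewMap a b ha hb)
        RiddledSkew.lebesgue RiddledSkew.topEdge ∧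
      RiddledSkew.IsChaoticAttractor (RiddledSkew.skewMap a b ha hb)
        RiddledSkew.lebesgue RiddledSkew.bottomEdge ∧
      RiddledSkew.HasLocallyRiddledBasin (RiddledSkew.skewMap a b ha hb)
        RiddledSkew.lebesgue RiddledSkew.bottomEdge) := by
  refine ⟨fun h => ?_, fun h => ?_⟩
  · have hω := RiddledSkew.ae_omegaSet_eq_topEdge ha hb h
    exact ⟨RiddledSkew.isChaoticSaddle_edge ha hb (Or.inl rfl)
        (RiddledSkew.measure_basin_eq_zero hω RiddledSkew.not_topEdge_subset_bottomEdge),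
      RiddledSkew.isChaoticAttractor_edge ha hb (Or.inr rfl) hω,
      RiddledSkew.hasLocallyRiddledBasin_topEdge ha hb⟩
  · have hω := RiddledSkew.ae_omegaSet_eq_bottomEdge ha hb h
    exact ⟨RiddledSkew.isChaoticSaddle_edge ha hb (Or.inr rfl)
        (RiddledSkew.measure_basin_eq_zero hω RiddledSkew.not_bottomEdge_subset_topEdge),
      RiddledSkew.isChaoticAttractor_edge ha hb (Or.inl rfl) hω,
      RiddledSkew.hasLocallyRiddledBasin_bottomEdge ha hb⟩
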